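/- **Lemma (a function on the real projective plane).** Let $\mathbb{C}^2$ have coordinates $z_1=x_1+ix_2$, $z_2=x_3+ix_4$, and let $\mathbb{S}=\{x_4=0,\ x_1^2+x_2^2+x_3^2=1\}$ be the unit sphere of the real hyperplane $x_4=0$. Let $\varphi:\mathbb{C}^2\to\mathbb{C}^2$, $\varphi(z_1,z_2)=(z_1^2,\,z_1z_2)$, let $\mathbb{P}=\varphi(\mathbb{S})$, and let $g(z_1,z_2)=\operatorname{Re}(z_1+\sqrt3\,z_2)=x_1+\sqrt3\,x_3$. For a compact set $X\subset\mathbb{C}^n$, let $\mathcal{C}(X)$ be the algebra of continuous complex-valued functions on $X$ and $\mathcal{P}(X)$ the uniform closure in $\mathcal{C}(X)$ of the holomorphic polynomials; $X$ is polynomially convex if for each $z\in\mathbb{C}^n\setminus X$ there is a polynomial $p$ with $|p|\le M$ on $X$ and $|p(z)|>M$ for some real $M$. Then: 1. The map $[x_1:x_2:x_3]\mapsto\varphi(x_1+ix_2,\,x_3)$, where $(x_1,x_2,x_3)$ is a representative with $x_1^2+x_2^2+x_3^2=1$, is a well-defined $\mathcal{C}^\infty$ embedding of the real projective plane in $\mathbb{C}^2$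 with image $\mathbb{P}$. So $\mathbb{P}$ is a smooth embedded submanifold of $\mathbb{C}^2$ diffeomorphic to the real projective plane. 2. The restriction of $g$ to $\mathbb{P}$ is a real-valued $\mathcal{C}^\infty$ function, and its graph $\{(z_1,z_2,g(z_1,z_2)):(z_1,z_2)\in\mathbb{P}\}$ is a totally real smooth embedded submanifold of $\mathbb{C}^3$: each of its tangent spaces $T\subset\mathbb{C}^3$ satisfies $T\cap iT=\{0\}$. 3. For every $t\in\mathbb{R}$ the fibre $F_t=\{z\in\mathbb{P}:g(z)=t\}$ is polynomially convex and satisfies $\mathcal{P}(F_t)=\mathcal{C}(F_t)$. 4. The maximum of $g$ on $\mathbb{P}$ is $\tfrac32$ and is attained only at the point $\bigl(\tfrac34,\tfrac{\sqrt3}{4}\bigr)$; the minimum of $g$ on $\mathbb{P}$ is $-1$ and is attained only at the point $(-1,0)$. -/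

import Mathlib

open scoped Manifold ContDiff

noncomputable section

/-! ## The real projective plane as a smooth manifold -/

/-- The real projective plane: the space of lines through the origin in `ℝ³`. -/
abbrev RealProjectivePlane : Type := Projectivization ℝ (Fin 3 → ℝ)

namespace RealProjectivePlane

/-- The quotient topology from `ℝ³ ∖ {0}`. -/
instance instTopologicalSpace : TopologicalSpace RealProjectivePlane :=
  inferInstanceAs (TopologicalSpace (Quotient (projectivizationSetoid ℝ (Fin 3 → ℝ))))

theorem isQuotientMap_mk' :
    Topology.IsQuotientMap (Projectivization.mk' ℝ : {v : Fin 3 → ℝ // v ≠ 0} → _) :=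
  isQuotientMap_quotient_mk'

/-- The affine open set of the lines `[v]` with `v i ≠ 0`. -/
def affineOpen (i : Fin 3) : Set RealProjectivePlane :=
  {q | Projectivization.lift (K := ℝ) (fun v : {v : Fin 3 → ℝ // v ≠ 0} => v.1 i ≠ 0)
    (by
      rintro ⟨a, ha⟩ ⟨b, hb⟩ t h
      have h' : a = t • b := h
      have ht : t ≠ 0 := by rintro rfl; exact ha (by simpa using h')
      simp [h', ht]) q}

theorem mk_mem_affineOpen {i : Fin 3} {v : Fin 3 → ℝ} {hv : v ≠ 0} :
    Projectivization.mk ℝ v hv ∈ affineOpen i ↔ v i ≠ 0 := Iff.rfl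

/-- The affine coordinates of `[v]`: the quotients of the two remaining coordinates of `v` by
`v i`. -/
def affineCoord (i : Fin 3) (q : RealProjectivePlane) : Fin 2 → ℝ :=
  Projectivization.lift (K := ℝ)
    (fun (v : {v : Fin 3 → ℝ // v ≠ 0}) (j : Fin 2) => v.1 (i.succAbove j) / v.1 i)
    (by
      rintro ⟨a, ha⟩ ⟨b, hb⟩ t h
      have h' : a = t • b := h
      have ht : t ≠ 0 := by rintro rfl; exact ha (by simpa using h')
      funext j
      simp [h', mul_div_mul_left _ _ ht]) q

theorem affineCoord_mk (i : Fin 3) (v : Fin 3 → ℝ) (hv : v ≠ 0) :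
    affineCoord i (Projectivization.mk ℝ v hv) = fun j => v (i.succAbove j) / v i := rfl

theorem insertNth_one_ne_zero (i : Fin 3) (y : Fin 2 → ℝ) :
    (i.insertNth (1 : ℝ) y : Fin 3 → ℝ) ≠ 0 := fun h => by
  have := congrFun h i
  simp at this

/-- The inverse of the affine chart: insert `1` as the `i`-th homogeneous coordinate. -/
def affineInv (i : Fin 3) (y : Fin 2 → ℝ) : RealProjectivePlane :=
  Projectivization.mk ℝ (i.insertNth (1 : ℝ) y : Fin 3 → ℝ) (insertNth_one_ne_zero i y)

theorem isOpen_affineOpen (i : Fin 3) : IsOpen (affineOpen i) := by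
  rw [← isQuotientMap_mk'.isOpen_preimage]
  have : Projectivization.mk' ℝ ⁻¹' affineOpen i =
      {v : {v : Fin 3 → ℝ // v ≠ 0} | v.1 i ≠ 0} := rfl
  rw [this]
  exact isOpen_ne_fun ((continuous_apply i).comp continuous_subtype_val) continuous_const

theorem contDiff_insertNth (i m : Fin 3) :
    ContDiff ℝ ∞ (fun y : Fin 2 → ℝ => (i.insertNth (1 : ℝ) y : Fin 3 → ℝ) m) := by
  induction m using i.succAboveCases with
  | x => simpa using contDiff_const
  | p j => simpa using contDiff_apply ℝ ℝ j

/-- The standard affine chart `[v] ↦ (v j / v i)_{j ≠ i}` on `{v i ≠ 0}`. -/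
def affineChart (i : Fin 3) : OpenPartialHomeomorph RealProjectivePlane (Fin 2 → ℝ) where
  toFun := affineCoord i
  invFun := affineInv i
  source := affineOpen i
  target := Set.univ
  map_source' _ _ := Set.mem_univ _
  map_target' y _ := by
    rw [affineInv, mk_mem_affineOpen]
    simp
  left_inv' q hq := by
    induction q using Projectivization.ind with
    | h v hv =>
      rw [mk_mem_affineOpen] at hq
      rw [affineCoord_mk, affineInv, Projectivization.mk_eq_mk_iff']
      refine ⟨(v i)⁻¹, ?_⟩
      funext m
      induction m using i.succAboveCases with
      | x => simp [hq]
      | p j => simp [div_eq_inv_mul]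
  right_inv' y _ := by
    rw [affineInv, affineCoord_mk]
    funext j
    simp
  open_source := isOpen_affineOpen i
  open_target := isOpen_univ
  continuousOn_toFun := by
    rw [isQuotientMap_mk'.continuousOn_isOpen_iff (isOpen_affineOpen i)]
    refine continuousOn_pi.2 fun j => ?_
    change ContinuousOn (fun v : {v : Fin 3 → ℝ // v ≠ 0} => v.1 (i.succAbove j) / v.1 i)
      {v | v.1 i ≠ 0}
    exact ContinuousOn.div ((continuous_apply _).comp continuous_subtype_val).continuousOn
      ((continuous_apply _).comp continuous_subtype_val).continuousOn fun v hv => hv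
  continuousOn_invFun := by
    refine Continuous.continuousOn ?_
    exact isQuotientMap_mk'.continuous.comp
      (Continuous.subtype_mk (continuous_pi fun m => (contDiff_insertNth i m).continuous)
        (insertNth_one_ne_zero i))

theorem exists_mem_affineOpen (q : RealProjectivePlane) : ∃ i, q ∈ affineOpen i := by
  induction q using Projectivization.ind with
  | h v hv => exact Function.ne_iff.1 hv

instance instChartedSpace : ChartedSpace (Fin 2 → ℝ) RealProjectivePlane where
  atlas := Set.range affineChart
  chartAt q := affineChart (exists_mem_affineOpen q).choose
  mem_chart_source _ := (exists_mem_affineOpen _).choose_spec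
  chart_mem_atlas _ := Set.mem_range_self _

instance instIsManifold : IsManifold 𝓘(ℝ, Fin 2 → ℝ) ∞ RealProjectivePlane := by
  refine isManifold_of_contDiffOn _ _ _ ?_
  rintro _ _ ⟨i, rfl⟩ ⟨j, rfl⟩
  refine contDiffOn_pi.2 fun k => ?_
  change ContDiffOn ℝ ∞ (fun y : Fin 2 → ℝ =>
    (i.insertNth (1 : ℝ) y : Fin 3 → ℝ) (j.succAbove k) /
      (i.insertNth (1 : ℝ) y : Fin 3 → ℝ) j) _
  refine ContDiffOn.div (contDiff_insertNth _ _).contDiffOn (contDiff_insertNth _ _).contDiffOn ?_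
  rintro y ⟨⟨_, hy⟩, _⟩
  exact hy

end RealProjectivePlane

/-! ## Polynomial convexity and totally real embeddings -/

/-- The polynomially convex hull of `X ⊆ ℂⁿ`: all `z` with `|p z| ≤ sup_X |p|` for every
holomorphic polynomial `p`. -/
def polynomialHull {n : ℕ} (X : Set (Fin n → ℂ)) : Set (Fin n → ℂ) :=
  {z | ∀ (p : MvPolynomial (Fin n) ℂ) (M : ℝ),
    (∀ x ∈ X, ‖MvPolynomial.eval x p‖ ≤ M) → ‖MvPolynomial.eval z p‖ ≤ M}

/-- A polynomially convex (compact) set is one that is equal to its polynomially convex hull. -/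
def IsPolynomiallyConvex {n : ℕ} (X : Set (Fin n → ℂ)) : Prop :=
  IsCompact X ∧ polynomialHull X = X

/-- The `i`-th coordinate function as a continuous function on `X ⊆ ℂⁿ`. -/
def coordOn {n : ℕ} (X : Set (Fin n → ℂ)) (i : Fin n) : C(X, ℂ) where
  toFun x := x.1 i
  continuous_toFun := (continuous_apply i).comp continuous_subtype_val

/-- The algebra `𝒫(X)`, for a compact set `X ⊆ ℂⁿ`: the closure in `𝒞(X)` of the restrictions to
`X` of the holomorphic polynomials. The topology of `C(X, ℂ)` is that of uniform convergence. -/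
def polynomialAlgebra {n : ℕ} (X : Set (Fin n → ℂ)) [CompactSpace X] : Subalgebra ℂ C(X, ℂ) :=
  (MvPolynomial.aeval (R := ℂ) (coordOn X)).range.topologicalClosure

/-- A real subspace `T` of `ℂⁿ` is totally real if `T ∩ iT = 0`. -/
def IsTotallyRealSubspace {n : ℕ} (T : Submodule ℝ (Fin n → ℂ)) : Prop :=
  ∀ v ∈ T, Complex.I • v ∈ T → v = 0

/-- A smooth embedding of a manifold in `ℂⁿ` is totally real if all the tangent spaces of its image
are totally real. -/
structure IsTotallyRealEmbedding {E M : Type} [NormedAddCommGroup E] [NormedSpace ℝ E]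
    [TopologicalSpace M] [ChartedSpace E M] {n : ℕ} (f : M → Fin n → ℂ) : Prop where
  isSmoothEmbedding : Manifold.IsSmoothEmbedding 𝓘(ℝ, E) 𝓘(ℝ, Fin n → ℂ) ∞ f
  isTotallyRealSubspace_tangent : ∀ q : M, IsTotallyRealSubspace
    (LinearMap.range (mfderiv 𝓘(ℝ, E) 𝓘(ℝ, Fin n → ℂ) f q : E →L[ℝ] (Fin n → ℂ)).toLinearMap)

/-! ## The surface and the function -/

namespace ProjectivePlaneFunction

/-- The unit sphere `x₁² + x₂² + x₃² = 1` of the real hyperplane `x₄ = 0` of `ℂ²`, with coordinates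
`z₁ = x₁ + i x₂` and `z₂ = x₃ + i x₄`. -/
def sphere : Set (Fin 2 → ℂ) :=
  {z | (z 0).re ^ 2 + (z 0).im ^ 2 + (z 1).re ^ 2 = 1 ∧ (z 1).im = 0}

/-- The map `(z₁, z₂) ↦ (z₁², z₁ z₂)`. -/
def phi (z : Fin 2 → ℂ) : Fin 2 → ℂ := ![z 0 ^ 2, z 0 * z 1]

/-- The surface `P`, the image of the sphere under `phi`. -/
def surface : Set (Fin 2 → ℂ) := phi '' sphere

/-- The function `g = x₁ + √3 x₃` on `ℂ²`. -/
def g (z : Fin 2 → ℂ) : ℝ := (z 0).re + √3 * (z 1).re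

/-- The point `(z₁, z₂, g (z₁, z₂))` of the graph of `g`. -/
def graphMap (z : Fin 2 → ℂ) : Fin 3 → ℂ := ![z 0, z 1, (g z : ℂ)]

/-- The fibre `F_t` of the restriction of `g` to `P`. -/
def fibre (t : ℝ) : Set (Fin 2 → ℂ) := {z ∈ surface | g z = t}

theorem isCompact_sphere : IsCompact sphere := by
  refine Metric.isCompact_of_isClosed_isBounded ?_ ?_
  · exact (isClosed_eq (by fun_prop) continuous_const).inter
      (isClosed_eq (by fun_prop) continuous_const)
  · refine (Metric.isBounded_closedBall (x := (0 : Fin 2 → ℂ)) (r := 1)).subset ?_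
    rintro z ⟨h1, h2⟩
    rw [mem_closedBall_zero_iff, pi_norm_le_iff_of_nonneg zero_le_one]
    intro i
    rw [← sq_le_one_iff₀ (norm_nonneg _), Complex.sq_norm, Complex.normSq_apply]
    fin_cases i
    · simp only [Fin.zero_eta]
      nlinarith [sq_nonneg (z 1).re]
    · simp only [Fin.mk_one, h2]
      nlinarith [sq_nonneg (z 0).re, sq_nonneg (z 0).im]

theorem isCompact_surface : IsCompact surface := by
  refine isCompact_sphere.image (continuous_pi fun i => ?_)
  fin_cases i
  · exact (continuous_apply 0).pow 2
  · exact (continuous_apply 0).mul (continuous_apply 1)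

instance instCompactSpaceFibre (t : ℝ) : CompactSpace (fibre t) :=
  isCompact_iff_compactSpace.1 <| isCompact_surface.inter_right <|
    isClosed_eq (by unfold g; fun_prop) continuous_const

end ProjectivePlaneFunction

end

/-!
The embedding is induced by the degree-zero homogeneous extension
`v ↦ (ζ², ζ v₃) / |v|²`, `ζ = v₁ + i v₂`, of the map on the sphere. Its derivative at `v` has
kernel `ℝ v` (`exists_eq_smul_of_fderiv_homMap_eq_zero`), so the induced map `psi` has injective
derivative. The inverse function theorem turns this into an immersion
(`isImmersionAtOfComplement_of_injective_mfderiv`), and compactness turns an injective immersion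
into an embedding.

Everything else rests on `g` being the real part of the linear form `w = z₁ + √3 z₂`.

* If `T` is a tangent plane of the graph and `v, i v ∈ T`, then the last coordinate of both is real,
  hence zero, so `w` vanishes on the projections of `v` and `i v`. Unless `v = 0`, these projections
  span the tangent plane of the surface, so `w` has a critical point on the surface; it has none
  (`exists_weightedSum_mfderiv_psi_ne_zero`).
* On the fibre `g = t` the conjugate of `w` is `2t - w`, so `𝒫(F_t)` contains every continuous
  function of `Im w`. By a special case of Bishop's theorem (`mem_of_forall_exists_eqOn_fibre`),
  `𝒫(F_t) = 𝒞(F_t)` follows from the same statement on the level sets of `w`. These are finite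
  (`finite_level`), and interpolation applies. Polynomial convexity follows from
  `𝒫(F_t) = 𝒞(F_t)` (`isPolynomiallyConvex_of_polynomialAlgebra_eq_top`).
* On the sphere, `g` is a quadratic form with eigenvalues `3/2`, `-1/2`, `-1`. Writing `3/2 - g` and
  `g + 1` as sums of squares gives its extrema.
-/

/-! ### Closed subalgebras of continuous functions containing a real function -/

/-- A closed subalgebra that contains a real function contains every continuous function of it,
by the Weierstrass approximation theorem. -/
theorem ofReal_comp_comp_mem_of_isClosed {X : Type*} [TopologicalSpace X] [CompactSpace X]
    {A : Subalgebra ℂ C(X, ℂ)} (hA : IsClosed (A : Set C(X, ℂ))) {u : C(X, ℝ)}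
    (hu : (ContinuousMap.mk ((↑) : ℝ → ℂ) Complex.continuous_ofReal).comp u ∈ A) (h : C(ℝ, ℝ)) :
    (ContinuousMap.mk ((↑) : ℝ → ℂ) Complex.continuous_ofReal).comp (h.comp u) ∈ A := by
  let φ : C(X, ℝ) →ₐ[ℝ] C(X, ℂ) := Complex.ofRealAm.compLeftContinuous ℝ Complex.continuous_ofReal
  let B : Subalgebra ℝ C(X, ℝ) := (A.restrictScalars ℝ).comap φ
  have hφ : Continuous φ := ContinuousMap.continuous_postcomp _
  have hB : IsClosed (B : Set C(X, ℝ)) := hA.preimage hφ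
  have huB : u ∈ B := hu
  have := ContinuousMap.comp_attachBound_mem_closure B ⟨u, huB⟩
    (h.comp ⟨Subtype.val, continuous_subtype_val⟩)
  rw [← SetLike.mem_coe, Subalgebra.topologicalClosure_coe, hB.closure_eq] at this
  exact this

/-- A special case of Bishop's generalised Stone-Weierstrass theorem: if a closed subalgebra `A`
contains a real function `u`, then membership of `f` in `A` can be tested on the level sets of `u`.
An element of `A` equal to `f` on `{u = s}` is close to `f` on `{u ∈ U s}` for a neighbourhood `U s`
of `s`, and finitely many such elements are glued by a partition of unity in the variable `u`,
whose members pulled back by `u` lie in `A`. -/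
theorem mem_of_forall_exists_eqOn_fibre {X : Type*} [TopologicalSpace X] [CompactSpace X]
    {A : Subalgebra ℂ C(X, ℂ)} (hA : IsClosed (A : Set C(X, ℂ))) {u : C(X, ℝ)}
    (hu : (ContinuousMap.mk ((↑) : ℝ → ℂ) Complex.continuous_ofReal).comp u ∈ A) {f : C(X, ℂ)}
    (hf : ∀ s : ℝ, ∃ a ∈ A, ∀ x, u x = s → a x = f x) : f ∈ A := by
  choose a haA haf using hf
  rw [← SetLike.mem_coe, ← hA.closure_eq, Metric.mem_closure_iff]
  intro ε hε
  -- The values near `s` at which `a s` is still a good approximation of `f`.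
  let U : ℝ → Set ℝ := fun s => (u '' {x | ε / 2 ≤ ‖f x - a s x‖})ᶜ
  -- `U s` is open because `u` is a closed map, `X` being compact.
  have hUo : ∀ s, IsOpen (U s) := fun s => by
    refine (IsCompact.image ?_ u.continuous).isClosed.isOpen_compl
    exact (isClosed_le continuous_const (by fun_prop)).isCompact
  have hsU : ∀ s, s ∈ U s := by
    rintro s ⟨x, hx, hxs⟩
    rw [Set.mem_ofPred_eq, haf s x hxs, sub_self, norm_zero] at hx
    linarith
  have hK : IsCompact (Set.range u) := isCompact_range u.continuous
  obtain ⟨t, ht⟩ := hK.elim_finite_subcover U hUo fun s _ => Set.mem_iUnion.2 ⟨s, hsU s⟩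
  obtain ⟨ρ, hρ⟩ := PartitionOfUnity.exists_isSubordinate hK.isClosed (fun s : t => U s)
    (fun s => hUo s) (by simpa [Set.iUnion_subtype] using ht)
  have hρ1 : ∀ x, ∑ s, ρ s (u x) = 1 := fun x => by
    rw [← finsum_eq_sum_of_fintype]; exact ρ.sum_eq_one ⟨x, rfl⟩
  refine ⟨∑ s : t, (ContinuousMap.mk ((↑) : ℝ → ℂ) Complex.continuous_ofReal).comp
    ((ρ s).comp u) * a s, ?_, ?_⟩
  · exact sum_mem fun s _ => mul_mem (ofReal_comp_comp_mem_of_isClosed hA hu _) (haA s)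
  · refine lt_of_le_of_lt ?_ (half_lt_self hε)
    rw [ContinuousMap.dist_le (by positivity)]
    intro x
    have h1 : f x = ∑ s : t, (ρ s (u x) : ℂ) * f x := by
      rw [← Finset.sum_mul, ← Complex.ofReal_sum, hρ1, Complex.ofReal_one, one_mul]
    calc dist (f x) _ = ‖∑ s : t, (ρ s (u x) : ℂ) * (f x - a s x)‖ := by
          rw [dist_eq_norm, h1]
          simp only [mul_sub, Finset.sum_sub_distrib, ← h1]
          simp
      _ ≤ ∑ s : t, ρ s (u x) * (ε / 2) := by
          refine (norm_sum_le _ _).trans (Finset.sum_le_sum fun s _ => ?_)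
          rw [norm_mul, Complex.norm_real, Real.norm_of_nonneg (ρ.nonneg s _)]
          by_cases h0 : ρ s (u x) = 0
          · simp [h0]
          · refine mul_le_mul_of_nonneg_left ?_ (ρ.nonneg s _)
            have hx : u x ∈ U s := hρ s (subset_tsupport _ h0)
            by_contra! hlt
            exact hx ⟨x, hlt.le, rfl⟩
      _ = ε / 2 := by rw [← Finset.sum_mul, hρ1, one_mul]

/-! ### Polynomial convexity from polynomial approximation -/

theorem aeval_coordOn_apply {n : ℕ} {X : Set (Fin n → ℂ)} (p : MvPolynomial (Fin n) ℂ) (x : X) :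
    MvPolynomial.aeval (coordOn X) p x = MvPolynomial.eval x.1 p := by
  induction p using MvPolynomial.induction_on with
  | C c => simp
  | add p q hp hq => simp [hp, hq]
  | mul_X p i hp => simp [hp, coordOn]

theorem exists_polynomial_norm_sub_lt {n : ℕ} {X : Set (Fin n → ℂ)} [CompactSpace X]
    {f : C(X, ℂ)} (hf : f ∈ polynomialAlgebra X) {ε : ℝ} (hε : 0 < ε) :
    ∃ p : MvPolynomial (Fin n) ℂ, ∀ x : X, ‖f x - MvPolynomial.eval x.1 p‖ < ε := by
  rw [polynomialAlgebra, ← SetLike.mem_coe, Subalgebra.topologicalClosure_coe,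
    Metric.mem_closure_iff] at hf
  obtain ⟨_, ⟨p, rfl⟩, hp⟩ := hf ε hε
  refine ⟨p, fun x => ?_⟩
  rw [← aeval_coordOn_apply, ← dist_eq_norm]
  exact (ContinuousMap.dist_apply_le_dist x).trans_lt hp

/-- If `𝒫(X) = 𝒞(X)` then `X` is polynomially convex. For `z ∉ X` the functions `x i - z i` have no
common zero on `X`, so `1 = ∑ i, (x i - z i) * G i x` on `X` with continuous `G i`. Replacing the
`G i` by nearby polynomials `q i` gives the polynomial `1 - ∑ i, (X i - z i) * q i`, which is small
on `X` and equal to `1` at `z`. -/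
theorem isPolynomiallyConvex_of_polynomialAlgebra_eq_top {n : ℕ} {X : Set (Fin n → ℂ)}
    [CompactSpace X] (h : polynomialAlgebra X = ⊤) : IsPolynomiallyConvex X := by
  refine ⟨isCompact_iff_compactSpace.2 inferInstance, Set.Subset.antisymm ?_ fun z hz p M hM =>
    hM z hz⟩
  intro z hz
  by_contra hzX
  have hD : ∀ x : X, (∑ i, (x.1 i - z i) * (starRingEnd ℂ) (x.1 i - z i)) ≠ 0 := by
    intro x hx
    simp only [Complex.mul_conj] at hx
    rw [← Complex.ofReal_sum, Complex.ofReal_eq_zero,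
      Finset.sum_eq_zero_iff_of_nonneg fun i _ => Complex.normSq_nonneg _] at hx
    refine hzX ?_
    convert x.2
    funext i
    exact (sub_eq_zero.1 (Complex.normSq_eq_zero.1 (hx i (Finset.mem_univ i)))).symm
  have hsub : ∀ i, Continuous fun x : X => x.1 i - z i := fun i =>
    ((continuous_apply i).comp continuous_subtype_val).sub continuous_const
  -- `G i` is the conjugate of `x i - z i` divided by `∑ i, |x i - z i|²`.
  let G : Fin n → C(X, ℂ) := fun i =>
    { toFun := fun x => (starRingEnd ℂ) (x.1 i - z i) /
        ∑ i, (x.1 i - z i) * (starRingEnd ℂ) (x.1 i - z i)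
      continuous_toFun := by
        refine Continuous.div ?_ ?_ hD
        · exact Complex.continuous_conj.comp (hsub i)
        · exact continuous_finsetSum _ fun i _ =>
            (hsub i).mul (Complex.continuous_conj.comp (hsub i)) }
  have hG : ∀ x : X, ∑ i, (x.1 i - z i) * G i x = 1 := fun x => by
    simp only [G, ContinuousMap.coe_mk, mul_div_assoc']
    rw [← Finset.sum_div, div_self (hD x)]
  obtain ⟨C, hC0, hC⟩ : ∃ C : ℝ, 0 < C ∧ ∀ (x : X) i, ‖x.1 i - z i‖ ≤ C := by
    have hX : IsCompact X := isCompact_iff_compactSpace.2 inferInstance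
    obtain ⟨C, hC⟩ := hX.isBounded.exists_norm_le
    refine ⟨|C| + ‖z‖ + 1, by positivity, fun x i => ?_⟩
    have h1 := (norm_le_pi_norm x.1 i).trans (hC x.1 x.2)
    have h2 := norm_le_pi_norm z i
    have h3 := le_abs_self C
    linarith [norm_sub_le (x.1 i) (z i)]
  have hε : 0 < 1 / (2 * C * (n + 1)) := by positivity
  choose q hq using fun i => exists_polynomial_norm_sub_lt (h ▸ Algebra.mem_top : G i ∈ _) hε
  have key := hz (1 - ∑ i, (MvPolynomial.X i - MvPolynomial.C (z i)) * q i) (1 / 2) ?_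
  · simp at key
    norm_num at key
  · intro x hx
    have : MvPolynomial.eval x (1 - ∑ i, (MvPolynomial.X i - MvPolynomial.C (z i)) * q i) =
        ∑ i, (x i - z i) * (G i ⟨x, hx⟩ - MvPolynomial.eval x (q i)) := by
      simp only [mul_sub, Finset.sum_sub_distrib, hG ⟨x, hx⟩]
      simp
    rw [this]
    calc _ ≤ ∑ _i : Fin n, C * (1 / (2 * C * (n + 1))) := by
          refine (norm_sum_le _ _).trans (Finset.sum_le_sum fun i _ => ?_)
          rw [norm_mul]
          exact mul_le_mul (hC ⟨x, hx⟩ i) (hq i ⟨x, hx⟩).le (norm_nonneg _) hC0.le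
      _ ≤ 1 / 2 := by
          rw [Finset.sum_const, Finset.card_univ, Fintype.card_fin, nsmul_eq_mul]
          have : (n : ℝ) * (C * (1 / (2 * C * (n + 1)))) = (n / (n + 1)) * (1 / 2) := by
            field_simp
          rw [this]
          have : (n : ℝ) / (n + 1) ≤ 1 := by
            rw [div_le_one (by positivity)]; linarith
          linarith

/-! ### Level sets of `z₁ + √3 z₂` on the surface -/

namespace ProjectivePlaneFunction

/-- On the surface `z₁ = ζ²` and `z₂ = ζ x₃` with `|ζ|² + x₃² = 1`, so `z₂² z̄₁ = |ζ|⁴ x₃²` is a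
function of `|z₁|`. -/
theorem sq_mul_conj_of_mem_surface {z : Fin 2 → ℂ} (hz : z ∈ surface) :
    z 1 ^ 2 * (starRingEnd ℂ) (z 0) = (‖z 0‖ : ℂ) ^ 2 * (1 - ‖z 0‖) := by
  obtain ⟨y, ⟨hy1, hy2⟩, rfl⟩ := hz
  have h1 : y 1 = ((y 1).re : ℂ) := by
    apply Complex.ext <;> simp [hy2]
  have hn : (‖y 0‖ : ℂ) ^ 2 = y 0 * (starRingEnd ℂ) (y 0) := (Complex.mul_conj' _).symm
  have hn' : (‖y 0‖ : ℂ) ^ 2 = 1 - y 1 ^ 2 := by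
    rw [hn, h1, Complex.mul_conj, Complex.normSq_apply]
    norm_cast
    linarith
  simp only [phi, Matrix.cons_val_zero, Matrix.cons_val_one, norm_pow, map_pow]
  push_cast
  rw [mul_pow, hn', ← hn', hn]
  linear_combination ((y 0 * (starRingEnd ℂ) (y 0)) ^ 2) * (hn.symm.trans hn')

/-- The level set `{z₁ + √3 z₂ = c}` of the surface. -/
def level (c : ℂ) : Set (Fin 2 → ℂ) := {z ∈ surface | z 0 + √3 * z 1 = c}

theorem eq_of_mem_level {c : ℂ} {z : Fin 2 → ℂ} (hz : z ∈ level c) :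
    z 1 = (c - z 0) / (√3 : ℝ) := by
  rw [eq_div_iff (by norm_num), ← hz.2]; ring

/-- Eliminating `z₂` on a level set gives an equation that is real-linear in `z₁` once `r = |z₁|` is
known. -/
theorem level_relation {c : ℂ} {z : Fin 2 → ℂ} (hz : z ∈ level c) :
    c ^ 2 * (starRingEnd ℂ) (z 0) + (‖z 0‖ : ℂ) ^ 2 * z 0 =
      (3 + 2 * c) * (‖z 0‖ : ℂ) ^ 2 - 3 * (‖z 0‖ : ℂ) ^ 3 := by
  have h := sq_mul_conj_of_mem_surface hz.1
  have hs : ((√3 : ℝ) : ℂ) ^ 2 = 3 := by norm_cast; simp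
  have hn : (‖z 0‖ : ℂ) ^ 2 = z 0 * (starRingEnd ℂ) (z 0) := (Complex.mul_conj' _).symm
  have h2 : (c - z 0) ^ 2 * (starRingEnd ℂ) (z 0) = 3 * ((‖z 0‖ : ℂ) ^ 2 * (1 - ‖z 0‖)) := by
    rw [← h, ← hs, ← hz.2]; ring
  linear_combination h2 + (z 0 - 2 * c) * hn

open Polynomial in
/-- A polynomial that vanishes at `r = |z₁|` for the points of `level c` with `r ≠ |c|`. There
`level_relation` and its conjugate, `c² z̄₁ + r² z₁ = R` and `c̄² z₁ + r² z̄₁ = R̄` with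
`R = (3 + 2c) r² - 3r³`, have determinant `r⁴ - |c|⁴`, and the polynomial is
`(r² R - c² R̄) (r² R̄ - c̄² R) - r² (r⁴ - |c|⁴)²`. -/
noncomputable def levelPoly (c : ℂ) : ℂ[X] :=
  (X ^ 2 * (C (3 + 2 * c) * X ^ 2 - 3 * X ^ 3) -
      C (c ^ 2) * (C (3 + 2 * (starRingEnd ℂ) c) * X ^ 2 - 3 * X ^ 3)) *
    (X ^ 2 * (C (3 + 2 * (starRingEnd ℂ) c) * X ^ 2 - 3 * X ^ 3) -
      C ((starRingEnd ℂ) c ^ 2) * (C (3 + 2 * c) * X ^ 2 - 3 * X ^ 3)) -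
    X ^ 2 * (X ^ 4 - C (c * (starRingEnd ℂ) c) ^ 2) ^ 2

open Polynomial in
theorem levelPoly_ne_zero (c : ℂ) : levelPoly c ≠ 0 := by
  -- `R` has leading term `-3r³`, so the coefficient of `r¹⁰` is `(-3) * (-3) - 1`.
  have h : (levelPoly c).coeff 10 = 8 := by
    unfold levelPoly
    compute_degree!
  intro h0
  rw [h0] at h
  norm_num at h

/-- The level sets are finite: `z₁` determines `z₂`. If `r = |z₁| ≠ |c|` then `r` is a root of
`levelPoly c` and determines `z₁` by a linear system; if `r = |c| ≠ 0` then `z₁` satisfies a monic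
quadratic equation. -/
theorem finite_level (c : ℂ) : (level c).Finite := by
  have hq : (Polynomial.X ^ 2 - Polynomial.C (3 + 2 * c - 3 * (‖c‖ : ℂ)) * Polynomial.X +
      Polynomial.C (c ^ 2)).Monic := by monicity!
  have hfin := (((Polynomial.finite_setOfPred_isRoot (levelPoly_ne_zero c)).image
    fun x : ℂ => (x ^ 2 * ((3 + 2 * c) * x ^ 2 - 3 * x ^ 3) - c ^ 2 *
      ((3 + 2 * (starRingEnd ℂ) c) * x ^ 2 - 3 * x ^ 3)) /
        (x ^ 4 - (c * (starRingEnd ℂ) c) ^ 2)).union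
    (Polynomial.finite_setOfPred_isRoot hq.ne_zero)).union (Set.finite_singleton (0 : ℂ))
  refine (hfin.image fun w => ![w, (c - w) / (√3 : ℝ)]).subset fun z hz => ⟨z 0, ?_, ?_⟩
  swap
  · funext i
    fin_cases i
    · rfl
    · exact (eq_of_mem_level hz).symm
  have h1 := level_relation hz
  have h2 := congrArg (starRingEnd ℂ) h1
  simp only [map_add, map_mul, map_sub, map_pow, map_ofNat, Complex.conj_conj,
    Complex.conj_ofReal] at h2
  have hn : (‖z 0‖ : ℂ) ^ 2 = z 0 * (starRingEnd ℂ) (z 0) := (Complex.mul_conj' _).symm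
  have hc : (‖c‖ : ℂ) ^ 2 = c * (starRingEnd ℂ) c := (Complex.mul_conj' _).symm
  set r : ℂ := (‖z 0‖ : ℂ) with hr
  set w := z 0
  set w' := (starRingEnd ℂ) w
  set c' := (starRingEnd ℂ) c
  have h3 : (r ^ 4 - (c * c') ^ 2) * w = r ^ 2 * ((3 + 2 * c) * r ^ 2 - 3 * r ^ 3) - c ^ 2 *
      ((3 + 2 * c') * r ^ 2 - 3 * r ^ 3) := by
    linear_combination r ^ 2 * h1 - c ^ 2 * h2
  have h4 : (r ^ 4 - (c * c') ^ 2) * w' = r ^ 2 * ((3 + 2 * c') * r ^ 2 - 3 * r ^ 3) - c' ^ 2 *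
      ((3 + 2 * c) * r ^ 2 - 3 * r ^ 3) := by
    linear_combination r ^ 2 * h2 - c' ^ 2 * h1
  by_cases hD : r ^ 4 - (c * c') ^ 2 = 0
  · by_cases hw : w = 0
    · exact Or.inr hw
    refine Or.inl (Or.inr ?_)
    have hrc : ‖w‖ = ‖c‖ := by
      have : ‖w‖ ^ 4 = ‖c‖ ^ 4 := by
        have : r ^ 4 = (‖c‖ : ℂ) ^ 4 := by
          linear_combination hD - ((‖c‖ : ℂ) ^ 2 + c * c') * hc
        rw [hr] at this
        exact_mod_cast this
      exact (pow_left_inj₀ (norm_nonneg _) (norm_nonneg _) (by norm_num)).1 this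
    have hc0 : c ≠ 0 := by
      rintro rfl
      exact hw (by simpa using hrc)
    have hc0' : c' ≠ 0 := by simpa [c'] using hc0
    have hrc' : r = (‖c‖ : ℂ) := by rw [hr, hrc]
    change Polynomial.eval w _ = 0
    simp only [Polynomial.eval_add, Polynomial.eval_sub, Polynomial.eval_mul, Polynomial.eval_pow,
      Polynomial.eval_X, Polynomial.eval_C]
    rw [← hrc'] at hc ⊢
    -- Use `z̄₁ = r² / z₁` and `r² = |c|²` in `level_relation`, and cancel `|c|²`.
    refine (mul_eq_zero.1 ?_ : c * c' = 0 ∨ _).resolve_left (mul_ne_zero hc0 hc0')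
    linear_combination w * h1 - c ^ 2 * (hc - hn) - (w ^ 2 - (3 + 2 * c - 3 * r) * w) * hc
  · refine Or.inl (Or.inl ⟨r, ?_, ?_⟩)
    · change Polynomial.eval r _ = 0
      simp only [levelPoly, Polynomial.eval_sub, Polynomial.eval_mul,
        Polynomial.eval_pow, Polynomial.eval_X, Polynomial.eval_C, Polynomial.eval_ofNat]
      rw [← h3, ← h4]
      linear_combination -(r ^ 4 - (c * c') ^ 2) ^ 2 * hn
    · beta_reduce
      rw [← h3]
      exact mul_div_cancel_left₀ _ hD

/-! ### Polynomial approximation on the fibres -/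

/-- On the fibre `g = t` the polynomial `z₁ + √3 z₂` has constant real part `t`, so its imaginary
part `u` is, up to an affine change, the restriction of a polynomial. The level sets of `u` are
finite, and `z₁` separates their points. -/
theorem polynomialAlgebra_fibre_eq_top (t : ℝ) : polynomialAlgebra (fibre t) = ⊤ := by
  rw [eq_top_iff]
  intro f _
  have hA : IsClosed (polynomialAlgebra (fibre t) : Set C(fibre t, ℂ)) :=
    Subalgebra.isClosed_topologicalClosure _
  have hcoord : ∀ p, MvPolynomial.aeval (coordOn (fibre t)) p ∈ polynomialAlgebra (fibre t) :=
    fun p => Subalgebra.le_topologicalClosure _ ⟨p, rfl⟩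
  let u : C(fibre t, ℝ) := ⟨fun x => (x.1 0 + √3 * x.1 1).im, Complex.continuous_im.comp
    (((continuous_apply 0).comp continuous_subtype_val).add
      (continuous_const.mul ((continuous_apply 1).comp continuous_subtype_val)))⟩
  -- On the fibre `z₁ + √3 z₂ = t + i u`.
  have hw : ∀ x : fibre t, x.1 0 + √3 * x.1 1 = (t : ℂ) + (u x : ℂ) * Complex.I := fun x => by
    have := x.2.2
    apply Complex.ext
    · simpa [g] using this
    · simp [u]
  have hu : (ContinuousMap.mk ((↑) : ℝ → ℂ) Complex.continuous_ofReal).comp u ∈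
      polynomialAlgebra (fibre t) := by
    convert hcoord (MvPolynomial.C (-Complex.I) *
      (MvPolynomial.X 0 + MvPolynomial.C ((√3 : ℝ) : ℂ) * MvPolynomial.X 1 -
        MvPolynomial.C (t : ℂ)))
    ext x
    rw [aeval_coordOn_apply]
    simp only [map_mul, map_add, map_sub, MvPolynomial.eval_C, MvPolynomial.eval_X, hw]
    simp only [ContinuousMap.comp_apply, ContinuousMap.coe_mk]
    linear_combination (u x : ℂ) * Complex.I_sq
  refine mem_of_forall_exists_eqOn_fibre hA hu fun s => ?_
  have hS : {x : fibre t | u x = s}.Finite := by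
    refine Set.Finite.of_finite_image ((finite_level (t + s * Complex.I)).subset ?_)
      Subtype.val_injective.injOn
    rintro _ ⟨x, hx, rfl⟩
    exact ⟨x.2.1, by rw [hw, show u x = s from hx]⟩
  have hinj : Set.InjOn (fun x : fibre t => x.1 0) hS.toFinset := by
    intro x hx y hy hxy
    have hx' : u x = s := by simpa using hx
    have hy' : u y = s := by simpa using hy
    have h0 : x.1 0 = y.1 0 := hxy
    refine Subtype.ext (funext fun i => ?_)
    fin_cases i
    · exact h0
    · rw [Fin.mk_one, eq_of_mem_level ⟨x.2.1, hw x⟩, eq_of_mem_level ⟨y.2.1, hw y⟩, hx', hy', h0]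
  let q := Lagrange.interpolate hS.toFinset (fun x : fibre t => x.1 0) f
  refine ⟨Polynomial.aeval (coordOn (fibre t) 0) q, ?_, fun x hx => ?_⟩
  · have := hcoord (Polynomial.aeval (MvPolynomial.X 0) q)
    rwa [← Polynomial.aeval_algHom_apply, MvPolynomial.aeval_X] at this
  · have := Lagrange.eval_interpolate_at_node f hinj (show x ∈ hS.toFinset by simpa using hx)
    rw [← this, ← Polynomial.coe_aeval_eq_eval]
    exact (Polynomial.aeval_algHom_apply (ContinuousMap.evalAlgHom ℂ ℂ x)
      (coordOn (fibre t) 0) q).symm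

/-! ### The extrema of `g` -/

theorem exists_eq_phi_of_mem_surface {z : Fin 2 → ℂ} (hz : z ∈ surface) :
    ∃ x₁ x₂ x₃ : ℝ, x₁ ^ 2 + x₂ ^ 2 + x₃ ^ 2 = 1 ∧
      z = phi ![(x₁ : ℂ) + x₂ * Complex.I, (x₃ : ℂ)] := by
  obtain ⟨y, ⟨hy1, hy2⟩, rfl⟩ := hz
  refine ⟨(y 0).re, (y 0).im, (y 1).re, hy1, congrArg phi (funext fun i => ?_)⟩
  fin_cases i
  · simp
  · apply Complex.ext <;> simp [hy2]

theorem phi_mem_surface {x₁ x₂ x₃ : ℝ} (h : x₁ ^ 2 + x₂ ^ 2 + x₃ ^ 2 = 1) :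
    phi ![(x₁ : ℂ) + x₂ * Complex.I, (x₃ : ℂ)] ∈ surface :=
  ⟨_, ⟨by simpa using h, by simp⟩, rfl⟩

theorem g_phi (x₁ x₂ x₃ : ℝ) : g (phi ![(x₁ : ℂ) + x₂ * Complex.I, (x₃ : ℂ)]) =
    x₁ ^ 2 - x₂ ^ 2 + √3 * (x₁ * x₃) := by
  simp [g, phi, sq]

theorem three_halves_sub_g_phi {x₁ x₂ x₃ : ℝ} (h : x₁ ^ 2 + x₂ ^ 2 + x₃ ^ 2 = 1) :
    3 / 2 - g (phi ![(x₁ : ℂ) + x₂ * Complex.I, (x₃ : ℂ)]) =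
      (x₁ - √3 * x₃) ^ 2 / 2 + 5 / 2 * x₂ ^ 2 := by
  have h3 : √3 ^ 2 = 3 := by simp
  rw [g_phi]
  linear_combination -(3 / 2) * h - x₃ ^ 2 / 2 * h3

theorem g_phi_add_one {x₁ x₂ x₃ : ℝ} (h : x₁ ^ 2 + x₂ ^ 2 + x₃ ^ 2 = 1) :
    g (phi ![(x₁ : ℂ) + x₂ * Complex.I, (x₃ : ℂ)]) + 1 =
      (x₃ + √3 / 2 * x₁) ^ 2 + 5 / 4 * x₁ ^ 2 := by
  have h3 : √3 ^ 2 = 3 := by simp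
  rw [g_phi]
  linear_combination -h - x₁ ^ 2 / 4 * h3

theorem g_le_three_halves {z : Fin 2 → ℂ} (hz : z ∈ surface) : g z ≤ 3 / 2 := by
  obtain ⟨x₁, x₂, x₃, h, rfl⟩ := exists_eq_phi_of_mem_surface hz
  have := three_halves_sub_g_phi h
  have : 0 ≤ (x₁ - √3 * x₃) ^ 2 / 2 + 5 / 2 * x₂ ^ 2 := by positivity
  linarith

theorem neg_one_le_g {z : Fin 2 → ℂ} (hz : z ∈ surface) : -1 ≤ g z := by
  obtain ⟨x₁, x₂, x₃, h, rfl⟩ := exists_eq_phi_of_mem_surface hz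
  have := g_phi_add_one h
  have : 0 ≤ (x₃ + √3 / 2 * x₁) ^ 2 + 5 / 4 * x₁ ^ 2 := by positivity
  linarith

theorem fibre_three_halves : fibre (3 / 2) = {![3 / 4, ((√3 : ℝ) : ℂ) / 4]} := by
  have h3 : √3 ^ 2 = 3 := by simp
  have h3' : ((√3 : ℝ) : ℂ) ^ 2 = 3 := by exact_mod_cast h3
  refine Set.Subset.antisymm ?_ (Set.singleton_subset_iff.2 ?_)
  · rintro z ⟨hz, hgz⟩
    obtain ⟨x₁, x₂, x₃, h, rfl⟩ := exists_eq_phi_of_mem_surface hz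
    have key := three_halves_sub_g_phi h
    rw [hgz, sub_self] at key
    have hx₂ : x₂ = 0 := by
      have : x₂ ^ 2 = 0 := by nlinarith [sq_nonneg (x₁ - √3 * x₃), sq_nonneg x₂]
      simpa using this
    have hx₁ : x₁ = √3 * x₃ := by
      have : (x₁ - √3 * x₃) ^ 2 = 0 := by nlinarith [sq_nonneg (x₁ - √3 * x₃), sq_nonneg x₂]
      linarith [pow_eq_zero_iff (two_ne_zero) |>.1 this]
    subst hx₂ hx₁
    have hx₃ : (x₃ : ℂ) ^ 2 = 1 / 4 := by
      have : x₃ ^ 2 = 1 / 4 := by linear_combination h / 4 - x₃ ^ 2 / 4 * h3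
      rw [← Complex.ofReal_pow, this]; norm_num
    refine Set.mem_singleton_iff.2 (funext fun i => ?_)
    fin_cases i
    · simp [phi, mul_pow, h3', hx₃]; norm_num
    · simp [phi]
      linear_combination (√3 : ℝ) * hx₃
  · have h : (√3 / 2) ^ 2 + (0 : ℝ) ^ 2 + (1 / 2) ^ 2 = 1 := by linear_combination h3 / 4
    have hp : (![3 / 4, ((√3 : ℝ) : ℂ) / 4] : Fin 2 → ℂ) =
        phi ![((√3 / 2 : ℝ) : ℂ) + (0 : ℝ) * Complex.I, ((1 / 2 : ℝ) : ℂ)] := by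
      funext i
      fin_cases i
      · simp [phi, div_pow, h3']; norm_num
      · simp [phi]; ring
    rw [hp]
    refine ⟨phi_mem_surface h, ?_⟩
    have := three_halves_sub_g_phi h
    linear_combination -this

theorem fibre_neg_one : fibre (-1) = {![-1, 0]} := by
  refine Set.Subset.antisymm ?_ (Set.singleton_subset_iff.2 ?_)
  · rintro z ⟨hz, hgz⟩
    obtain ⟨x₁, x₂, x₃, h, rfl⟩ := exists_eq_phi_of_mem_surface hz
    have key := g_phi_add_one h
    rw [hgz, neg_add_cancel] at key
    have hx₁ : x₁ = 0 := by
      have : x₁ ^ 2 = 0 := by nlinarith [sq_nonneg (x₃ + √3 / 2 * x₁), sq_nonneg x₁]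
      simpa using this
    subst hx₁
    have hx₃ : x₃ = 0 := by simpa [eq_comm] using key
    subst hx₃
    have hx₂ : (x₂ : ℂ) ^ 2 = 1 := by
      have : x₂ ^ 2 = 1 := by linear_combination h
      exact_mod_cast this
    refine Set.mem_singleton_iff.2 (funext fun i => ?_)
    fin_cases i
    · simp [phi, mul_pow, hx₂]
    · simp [phi]
  · have h : (0 : ℝ) ^ 2 + (1 : ℝ) ^ 2 + (0 : ℝ) ^ 2 = 1 := by norm_num
    have hp : (![-1, 0] : Fin 2 → ℂ) =
        phi ![((0 : ℝ) : ℂ) + (1 : ℝ) * Complex.I, ((0 : ℝ) : ℂ)] := by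
      funext i
      fin_cases i <;> simp [phi]
    rw [hp]
    refine ⟨phi_mem_surface h, ?_⟩
    have := g_phi_add_one h
    linear_combination this

theorem isGreatest_g : IsGreatest (g '' surface) (3 / 2) := by
  have h : (![3 / 4, ((√3 : ℝ) : ℂ) / 4] : Fin 2 → ℂ) ∈ fibre (3 / 2) := by
    rw [fibre_three_halves]; exact rfl
  exact ⟨⟨_, h⟩, Set.forall_mem_image.2 fun _ hz => g_le_three_halves hz⟩

theorem isLeast_g : IsLeast (g '' surface) (-1) := by
  have h : (![-1, 0] : Fin 2 → ℂ) ∈ fibre (-1) := by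
    rw [fibre_neg_one]; exact rfl
  exact ⟨⟨_, h⟩, Set.forall_mem_image.2 fun _ hz => neg_one_le_g hz⟩

end ProjectivePlaneFunction

/-! ### Maps with injective derivative are immersions -/

theorem exists_continuousLinearEquiv_prod_of_injective {E F F' : Type*}
    [NormedAddCommGroup E] [NormedSpace ℝ E] [FiniteDimensional ℝ E]
    [NormedAddCommGroup F] [NormedSpace ℝ F] [FiniteDimensional ℝ F]
    [NormedAddCommGroup F'] [NormedSpace ℝ F'] [FiniteDimensional ℝ F']
    (hdim : Module.finrank ℝ E + Module.finrank ℝ F = Module.finrank ℝ F')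
    {A : E →L[ℝ] F'} (hA : Function.Injective A) :
    ∃ L : (E × F) ≃L[ℝ] F', ∀ u, L (u, 0) = A u := by
  obtain ⟨C, hC⟩ := Submodule.exists_isCompl (LinearMap.range A.toLinearMap)
  have hdC : Module.finrank ℝ F = Module.finrank ℝ C := by
    have h1 := Submodule.finrank_add_eq_of_isCompl hC
    have h2 := LinearMap.finrank_range_of_inj hA
    have h3 : Module.finrank ℝ (LinearMap.range A.toLinearMap) = Module.finrank ℝ E := h2
    omega
  let B : F ≃ₗ[ℝ] C := LinearEquiv.ofFinrankEq F C hdC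
  let L₀ : E × F →ₗ[ℝ] F' := A.toLinearMap.coprod (C.subtype ∘ₗ B.toLinearMap)
  have hL₀ : Function.Injective L₀ := by
    refine LinearMap.ker_eq_bot.1 (LinearMap.ker_coprod_of_disjoint_range _ _ ?_ |>.trans ?_)
    · refine hC.disjoint.mono_right ?_
      rintro _ ⟨v, rfl⟩
      exact (B v).2
    · rw [LinearMap.ker_eq_bot.2 hA, LinearMap.ker_eq_bot.2
        (Subtype.val_injective.comp B.injective), Submodule.prod_bot]
  refine ⟨(LinearMap.linearEquivOfInjective L₀ hL₀ ?_).toContinuousLinearEquiv, fun u => ?_⟩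
  · rw [Module.finrank_prod, hdim]
  · simp [L₀]

theorem mfderiv_eq_fderiv_comp_chartAt_symm {E F' M : Type*}
    [NormedAddCommGroup E] [NormedSpace ℝ E] [NormedAddCommGroup F'] [NormedSpace ℝ F']
    [TopologicalSpace M] [ChartedSpace E M] {f : M → F'} {q : M}
    (hf : MDifferentiableAt 𝓘(ℝ, E) 𝓘(ℝ, F') f q) :
    mfderiv 𝓘(ℝ, E) 𝓘(ℝ, F') f q = fderiv ℝ (f ∘ (chartAt E q).symm) (chartAt E q q) := by
  rw [hf.mfderiv, ← fderivWithin_univ]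
  simp [writtenInExtChartAt, mfld_simps]
  rfl

theorem contMDiff_of_contDiffOn_comp_chartAt_symm {E F' M : Type*}
    [NormedAddCommGroup E] [NormedSpace ℝ E] [NormedAddCommGroup F'] [NormedSpace ℝ F']
    [TopologicalSpace M] [ChartedSpace E M] [IsManifold 𝓘(ℝ, E) ∞ M] {f : M → F'}
    (hf : ∀ q, ContDiffOn ℝ ∞ (f ∘ (chartAt E q).symm) (chartAt E q).target) :
    ContMDiff 𝓘(ℝ, E) 𝓘(ℝ, F') ∞ f := by
  intro q
  have h := (contMDiffOn_iff_contDiffOn.2 (hf q)).comp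
    (contMDiffOn_chart (I := 𝓘(ℝ, E)) (n := ∞) (x := q)) fun x hx => (chartAt E q).map_source hx
  refine (h.congr fun x hx => ?_).contMDiffAt
    ((chartAt E q).open_source.mem_nhds (mem_chart_source E q))
  simp [(chartAt E q).left_inv hx]

/-- A smooth map to a finite-dimensional vector space is an immersion wherever its derivative is
injective, by the inverse function theorem. The complement `F` may be any space of the right
dimension. -/
theorem isImmersionAtOfComplement_of_injective_mfderiv {E F F' M : Type*}
    [NormedAddCommGroup E] [NormedSpace ℝ E] [FiniteDimensional ℝ E]
    [NormedAddCommGroup F] [NormedSpace ℝ F] [FiniteDimensional ℝ F]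
    [NormedAddCommGroup F'] [NormedSpace ℝ F'] [FiniteDimensional ℝ F']
    [TopologicalSpace M] [ChartedSpace E M] [IsManifold 𝓘(ℝ, E) ∞ M]
    (hdim : Module.finrank ℝ E + Module.finrank ℝ F = Module.finrank ℝ F')
    {f : M → F'} (hf : ContMDiff 𝓘(ℝ, E) 𝓘(ℝ, F') ∞ f) {q : M}
    (hinj : Function.Injective (mfderiv 𝓘(ℝ, E) 𝓘(ℝ, F') f q)) :
    Manifold.IsImmersionAtOfComplement F 𝓘(ℝ, E) 𝓘(ℝ, F') ∞ f q := by
  have := FiniteDimensional.complete ℝ F'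
  let e := chartAt E q
  let h : E → F' := f ∘ e.symm
  have hq : q ∈ e.source := mem_chart_source E q
  have hh : ContDiffOn ℝ ∞ h e.target := by
    rw [← contMDiffOn_iff_contDiffOn]
    exact hf.comp_contMDiffOn (contMDiffOn_chart_symm (I := 𝓘(ℝ, E)))
  have hmf : mfderiv 𝓘(ℝ, E) 𝓘(ℝ, F') f q = fderiv ℝ h (e q) :=
    mfderiv_eq_fderiv_comp_chartAt_symm (hf.mdifferentiableAt (by simp))
  have hhq : ContDiffAt ℝ ∞ h (e q) := hh.contDiffAt (e.open_target.mem_nhds (e.map_source hq))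
  obtain ⟨L, hL⟩ := exists_continuousLinearEquiv_prod_of_injective (F := F) hdim
    (A := fderiv ℝ h (e q)) (by rw [← hmf]; exact hinj)
  -- `G` extends `h` from the slice `{L (u, 0)}`, with derivative the identity at `L (e q, 0)`.
  let G : F' → F' := fun w => h (L.symm w).1 + L (0, (L.symm w).2)
  let w₀ : F' := L (e q, 0)
  have hGL : ∀ u, G (L (u, 0)) = h u := fun u => by
    have : L (0, 0) = 0 := map_zero L
    simp [G, this]
  let S : Set F' := {w | (L.symm w).1 ∈ e.target}
  have hS : IsOpen S := e.open_target.preimage (by fun_prop)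
  have hw₀S : w₀ ∈ S := by simpa [S, w₀] using e.map_source hq
  have hGS : ContDiffOn ℝ ∞ G S := by
    refine ContDiffOn.add (hh.comp (t := e.target) ?_ fun w hw => hw) ?_
    · exact (contDiff_fst.comp L.symm.contDiff).contDiffOn
    · exact (L.contDiff.comp (contDiff_const.prodMk
        (contDiff_snd.comp L.symm.contDiff))).contDiffOn
  have hG₀ : HasFDerivAt G ((ContinuousLinearEquiv.refl ℝ F' : F' ≃L[ℝ] F') : F' →L[ℝ] F') w₀ := by
    have h1 : HasFDerivAt h (fderiv ℝ h (e q)) (L.symm w₀).1 := by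
      simpa [w₀] using (hhq.differentiableAt (by simp)).hasFDerivAt
    have h2 := (h1.comp w₀ (L.symm.hasFDerivAt.fst (x := w₀))).add
      (L.hasFDerivAt.comp w₀ ((hasFDerivAt_const (0 : E) w₀).prodMk
        (L.symm.hasFDerivAt.snd (x := w₀))))
    refine h2.congr_fderiv ?_
    ext w
    have : L ((L.symm w).1, 0) + L (0, (L.symm w).2) = w := by
      rw [← map_add]; simp
    simpa [hL] using this
  have hGw₀ : ContDiffAt ℝ ∞ G w₀ := hGS.contDiffAt (hS.mem_nhds hw₀S)
  let Φ₀ := hGw₀.toOpenPartialHomeomorph G hG₀ (by simp)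
  -- A chart must be smooth with smooth inverse on all of its domain, so the local inverse is
  -- restricted to the open set where the derivative of `G` is invertible.
  let T : Set F' := S ∩ fderiv ℝ G ⁻¹' Set.range ((↑) : (F' ≃L[ℝ] F') → F' →L[ℝ] F')
  have hT : IsOpen T := (hGS.continuousOn_fderiv_of_isOpen hS (by simp)).isOpen_inter_preimage hS
    (ContinuousLinearEquiv.isOpen (𝕜 := ℝ) (E := F') (F := F'))
  let Φ := Φ₀.restr T
  have hΦ : Φ.source = Φ₀.source ∩ T := Φ₀.restr_source' T hT
  have hw₀ : w₀ ∈ Φ.source := by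
    rw [hΦ]
    exact ⟨hGw₀.mem_toOpenPartialHomeomorph_source hG₀ _, hw₀S, ⟨_, hG₀.fderiv.symm⟩⟩
  have hΦG : ∀ w, Φ w = G w := fun w => rfl
  have hcont : ContDiffOn ℝ ∞ Φ Φ.source :=
    hGS.mono fun w hw => (hΦ ▸ hw).2.1
  have hcont' : ContDiffOn ℝ ∞ Φ.symm Φ.target := by
    intro x hx
    have hx' := Φ.map_target hx
    have hx'' := hx'
    rw [hΦ] at hx''
    obtain ⟨-, hxS, B, hB⟩ := hx''
    have hGx := hGS.contDiffAt (hS.mem_nhds hxS)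
    refine (Φ.contDiffAt_symm (f₀' := B) hx ?_ hGx).contDiffWithinAt
    rw [hB]
    exact (hGx.differentiableAt (by simp)).hasFDerivAt
  have hfq : f q = G w₀ := by
    rw [hGL]; simp [h, e.left_inv hq]
  let V : Set M := e.source ∩ e ⁻¹' {u | L (u, 0) ∈ Φ.source}
  have hV : IsOpen V := e.isOpen_inter_preimage (Φ.open_source.preimage (by fun_prop))
  refine Manifold.IsImmersionAtOfComplement.mk_of_continuousAt hf.continuous.continuousAt L
    (e.restr V) Φ.symm ?_ ?_ ?_ ?_ ?_
  · rw [e.restr_source' V hV]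
    exact ⟨hq, hq, hw₀⟩
  · rw [hfq]
    exact Φ.map_source hw₀
  · exact restr_mem_maximalAtlas _ (IsManifold.chart_mem_maximalAtlas q) hV
  · refine StructureGroupoid.mem_maximalAtlas_of_mem_groupoid _ ?_
    rw [contDiffGroupoid, mem_groupoid_of_pregroupoid]
    simpa [contDiffPregroupoid] using ⟨hcont', hcont⟩
  · intro u hu
    have hu' : u ∈ e.target ∧ L (u, 0) ∈ Φ.source := by
      have h1 : u ∈ e.target ∧ e.symm u ∈ interior V := by
        simpa [mfld_simps] using hu
      rw [hV.interior_eq] at h1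
      refine ⟨h1.1, ?_⟩
      have := h1.2.2
      simpa [e.right_inv h1.1] using this
    have : Φ.symm (h u) = L (u, 0) := by
      rw [← hGL, ← hΦG]
      exact Φ.left_inv hu'.2
    simpa [h] using this

theorem isSmoothEmbedding_of_injective_mfderiv {E F' M : Type*}
    [NormedAddCommGroup E] [NormedSpace ℝ E] [FiniteDimensional ℝ E]
    [NormedAddCommGroup F'] [NormedSpace ℝ F'] [FiniteDimensional ℝ F']
    [TopologicalSpace M] [CompactSpace M] [ChartedSpace E M] [IsManifold 𝓘(ℝ, E) ∞ M]
    {f : M → F'} (hf : ContMDiff 𝓘(ℝ, E) 𝓘(ℝ, F') ∞ f) (hfi : Function.Injective f)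
    (hinj : ∀ q, Function.Injective (mfderiv 𝓘(ℝ, E) 𝓘(ℝ, F') f q)) :
    Manifold.IsSmoothEmbedding 𝓘(ℝ, E) 𝓘(ℝ, F') ∞ f where
  isEmbedding := (hf.continuous.isClosedEmbedding hfi).isEmbedding
  isImmersion := Manifold.IsImmersionOfComplement.isImmersion
    (F := Fin (Module.finrank ℝ F' - Module.finrank ℝ E) → ℝ) fun q => by
      have hdim : Module.finrank ℝ E ≤ Module.finrank ℝ F' :=
        LinearMap.finrank_le_finrank_of_injective (f := (mfderiv 𝓘(ℝ, E) 𝓘(ℝ, F') f q :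
          E →L[ℝ] F').toLinearMap) (hinj q)
      exact isImmersionAtOfComplement_of_injective_mfderiv (by simp [hdim]) hf (hinj q)

/-! ### Compactness and affine charts of the projective plane -/

namespace RealProjectivePlane

theorem sum_sq_ne_zero {v : Fin 3 → ℝ} (hv : v ≠ 0) : v 0 ^ 2 + v 1 ^ 2 + v 2 ^ 2 ≠ 0 := by
  intro h
  refine hv (funext fun i => ?_)
  rw [Pi.zero_apply, ← sq_eq_zero_iff]
  fin_cases i <;> simp only [Fin.zero_eta, Fin.mk_one, Fin.reduceFinMk] <;>
    nlinarith [sq_nonneg (v 0), sq_nonneg (v 1), sq_nonneg (v 2)]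

theorem exists_mk_eq_of_sum_sq_eq_one (q : RealProjectivePlane) :
    ∃ (x : Fin 3 → ℝ) (hx : x ≠ 0), x 0 ^ 2 + x 1 ^ 2 + x 2 ^ 2 = 1 ∧
      Projectivization.mk ℝ x hx = q := by
  induction q using Projectivization.ind with
  | h v hv =>
    have hN : 0 < v 0 ^ 2 + v 1 ^ 2 + v 2 ^ 2 :=
      lt_of_le_of_ne (by positivity) (sum_sq_ne_zero hv).symm
    set N := v 0 ^ 2 + v 1 ^ 2 + v 2 ^ 2 with hNdef
    have hs : (√N)⁻¹ ≠ 0 := inv_ne_zero (Real.sqrt_ne_zero'.2 hN)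
    refine ⟨(√N)⁻¹ • v, smul_ne_zero hs hv, ?_, ?_⟩
    · simp only [Pi.smul_apply, smul_eq_mul, mul_pow, inv_pow, Real.sq_sqrt hN.le]
      rw [← mul_add, ← mul_add, ← hNdef, inv_mul_cancel₀ hN.ne']
    · rw [Projectivization.mk_eq_mk_iff']
      exact ⟨_, rfl⟩

instance instCompactSpace : CompactSpace RealProjectivePlane := by
  let K : Set (Fin 3 → ℝ) := {x | x 0 ^ 2 + x 1 ^ 2 + x 2 ^ 2 = 1}
  have hK : IsCompact K := by
    refine Metric.isCompact_of_isClosed_isBounded (isClosed_eq (by fun_prop) continuous_const) ?_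
    refine (Metric.isBounded_closedBall (x := (0 : Fin 3 → ℝ)) (r := 1)).subset fun x hx => ?_
    have hx : x 0 ^ 2 + x 1 ^ 2 + x 2 ^ 2 = 1 := hx
    rw [mem_closedBall_zero_iff, pi_norm_le_iff_of_nonneg zero_le_one]
    intro i
    rw [Real.norm_eq_abs, ← sq_le_one_iff_abs_le_one]
    fin_cases i <;> simp only [Fin.zero_eta, Fin.mk_one, Fin.reduceFinMk] <;>
      nlinarith [sq_nonneg (x 0), sq_nonneg (x 1), sq_nonneg (x 2)]
  have : CompactSpace K := isCompact_iff_compactSpace.1 hK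
  have hK0 : ∀ x : K, x.1 ≠ 0 := by
    rintro ⟨x, hx⟩ rfl
    simp [K] at hx
  refine Function.Surjective.compactSpace (f := fun x : K => Projectivization.mk' ℝ ⟨x.1, hK0 x⟩)
    (hf := isQuotientMap_mk'.continuous.comp (continuous_subtype_val.subtype_mk hK0)) ?_
  intro q
  obtain ⟨x, hx, hx1, rfl⟩ := exists_mk_eq_of_sum_sq_eq_one q
  exact ⟨⟨x, hx1⟩, rfl⟩

/-- The linear map that inserts `0` as the `i`-th coordinate: the derivative of the inverse of the
`i`-th affine chart, lifted to `ℝ³`. -/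
noncomputable def insertZero (i : Fin 3) : (Fin 2 → ℝ) →L[ℝ] (Fin 3 → ℝ) :=
  LinearMap.toContinuousLinearMap
    { toFun := fun y => i.insertNth (0 : ℝ) y
      map_add' := fun y y' => by
        funext m
        induction m using i.succAboveCases <;> simp
      map_smul' := fun c y => by
        funext m
        induction m using i.succAboveCases <;> simp }

theorem insertZero_apply (i : Fin 3) (y : Fin 2 → ℝ) :
    insertZero i y = (i.insertNth (0 : ℝ) y : Fin 3 → ℝ) := rfl

theorem insertZero_injective (i : Fin 3) : Function.Injective (insertZero i) := fun y y' h => by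
  funext j
  simpa [insertZero_apply] using congrFun h (i.succAbove j)

theorem insertNth_one_eq (i : Fin 3) (y : Fin 2 → ℝ) :
    (i.insertNth (1 : ℝ) y : Fin 3 → ℝ) = Pi.single i 1 + insertZero i y := by
  funext m
  induction m using i.succAboveCases <;> simp [insertZero_apply]

theorem hasFDerivAt_insertNth_one (i : Fin 3) (y : Fin 2 → ℝ) :
    HasFDerivAt (fun y : Fin 2 → ℝ => (i.insertNth (1 : ℝ) y : Fin 3 → ℝ)) (insertZero i) y := by
  simp only [insertNth_one_eq]
  exact (insertZero i).hasFDerivAt.const_add _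

end RealProjectivePlane

/-! ### The map to the surface -/

namespace ProjectivePlaneFunction
open RealProjectivePlane

/-- The point `(x₁ + i x₂, x₃)` of `ℂ²`. -/
def complexCoords (v : Fin 3 → ℝ) : Fin 2 → ℂ := ![(v 0 : ℂ) + (v 1 : ℂ) * Complex.I, (v 2 : ℂ)]

/-- The extension of `v ↦ phi (v₁ + i v₂, v₃)` from the unit sphere to `ℝ³ ∖ {0}` that is
homogeneous of degree `0`. At `v = 0` its value is `0`. -/
noncomputable def homMap (v : Fin 3 → ℝ) : Fin 2 → ℂ :=
  (v 0 ^ 2 + v 1 ^ 2 + v 2 ^ 2)⁻¹ • phi (complexCoords v)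

theorem sum_sq_mul_homMap {v : Fin 3 → ℝ} (hv : v ≠ 0) (i : Fin 2) :
    ((v 0 ^ 2 + v 1 ^ 2 + v 2 ^ 2 : ℝ) : ℂ) * homMap v i = phi (complexCoords v) i := by
  rw [homMap, Pi.smul_apply, Complex.real_smul, ← mul_assoc, ← Complex.ofReal_mul,
    mul_inv_cancel₀ (sum_sq_ne_zero hv), Complex.ofReal_one, one_mul]

theorem homMap_smul (v : Fin 3 → ℝ) {c : ℝ} (hc : c ≠ 0) : homMap (c • v) = homMap v := by
  have h1 : phi (complexCoords (c • v)) = c ^ 2 • phi (complexCoords v) := by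
    funext i
    fin_cases i <;> simp [phi, complexCoords] <;> ring
  have h2 : (c • v) 0 ^ 2 + (c • v) 1 ^ 2 + (c • v) 2 ^ 2 =
      c ^ 2 * (v 0 ^ 2 + v 1 ^ 2 + v 2 ^ 2) := by
    simp; ring
  rw [homMap, h1, h2, smul_smul, homMap, mul_inv, mul_comm (c ^ 2)⁻¹, mul_assoc,
    inv_mul_cancel₀ (pow_ne_zero 2 hc), mul_one]

/-- The map from the real projective plane to `ℂ²` induced by `homMap`. -/
noncomputable def psi : RealProjectivePlane → Fin 2 → ℂ :=
  Projectivization.lift (fun v => homMap v.1) (by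
    rintro ⟨a, ha⟩ ⟨b, hb⟩ t h
    have h' : a = t • b := h
    have ht : t ≠ 0 := by rintro rfl; exact ha (by simpa using h')
    simp only [h', homMap_smul _ ht])

theorem psi_mk (v : Fin 3 → ℝ) (hv : v ≠ 0) : psi (Projectivization.mk ℝ v hv) = homMap v := rfl

theorem psi_mk_of_sum_sq_eq_one {x : Fin 3 → ℝ} (hx : x ≠ 0)
    (h : x 0 ^ 2 + x 1 ^ 2 + x 2 ^ 2 = 1) :
    psi (Projectivization.mk ℝ x hx) = phi (complexCoords x) := by
  rw [psi_mk, homMap, h, inv_one, one_smul]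

theorem range_psi : Set.range psi = surface := by
  refine Set.Subset.antisymm ?_ fun z hz => ?_
  · rintro _ ⟨q, rfl⟩
    obtain ⟨x, hx, h, rfl⟩ := exists_mk_eq_of_sum_sq_eq_one q
    rw [psi_mk_of_sum_sq_eq_one hx h]
    exact phi_mem_surface h
  · obtain ⟨x₁, x₂, x₃, h, rfl⟩ := exists_eq_phi_of_mem_surface hz
    have hx : ![x₁, x₂, x₃] ≠ 0 := by
      intro h0
      have h1 := congrFun h0 0
      have h2 := congrFun h0 1
      have h3 := congrFun h0 2
      simp at h1 h2 h3
      simp [h1, h2, h3] at h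
    exact ⟨Projectivization.mk ℝ _ hx, psi_mk_of_sum_sq_eq_one hx h⟩

theorem eq_zero_of_add_mul_I_eq_zero {a b : ℝ} (h : (a : ℂ) + b * Complex.I = 0) :
    a = 0 ∧ b = 0 := by
  have h1 := congrArg Complex.re h
  have h2 := congrArg Complex.im h
  simp at h1 h2
  exact ⟨h1, h2⟩

theorem psi_injective : Function.Injective psi := by
  intro q q' hqq
  obtain ⟨x, hx, h, rfl⟩ := exists_mk_eq_of_sum_sq_eq_one q
  obtain ⟨y, hy, h', rfl⟩ := exists_mk_eq_of_sum_sq_eq_one q'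
  rw [psi_mk_of_sum_sq_eq_one hx h, psi_mk_of_sum_sq_eq_one hy h'] at hqq
  have e0 := congrFun hqq 0
  have e1 := congrFun hqq 1
  simp only [phi, complexCoords, Matrix.cons_val_zero, Matrix.cons_val_one] at e0 e1
  rw [Projectivization.mk_eq_mk_iff']
  -- Equality of the squares `ζ²` gives `ζ` up to a sign `ε`.
  obtain ⟨ε, hε, hζ⟩ : ∃ ε : ℝ, ε ^ 2 = 1 ∧
      (x 0 : ℂ) + x 1 * Complex.I = ε * ((y 0 : ℂ) + y 1 * Complex.I) := by
    rcases sq_eq_sq_iff_eq_or_eq_neg.1 e0 with h | h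
    · exact ⟨1, by simp, by simpa using h⟩
    · exact ⟨-1, by simp, by rw [h]; simp⟩
  have hζ0 := congrArg Complex.re hζ
  have hζ1 := congrArg Complex.im hζ
  simp at hζ0 hζ1
  by_cases hy0 : (y 0 : ℂ) + y 1 * Complex.I = 0
  · obtain ⟨a0, a1⟩ := eq_zero_of_add_mul_I_eq_zero hy0
    rw [a0, mul_zero] at hζ0
    rw [a1, mul_zero] at hζ1
    have hy2 : y 2 ^ 2 = 1 := by simpa [a0, a1] using h'
    refine ⟨x 2 * y 2, funext fun i => ?_⟩
    fin_cases i
    · simp [a0, hζ0]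
    · simp [a1, hζ1]
    · simp only [Fin.reduceFinMk, Pi.smul_apply, smul_eq_mul]
      linear_combination x 2 * hy2
  · have hx2 : (ε : ℂ) * x 2 = y 2 := by
      refine mul_left_cancel₀ hy0 ?_
      rw [← e1, hζ]; ring
    have hx2' : ε * x 2 = y 2 := by exact_mod_cast hx2
    refine ⟨ε, funext fun i => ?_⟩
    fin_cases i
    · simp [hζ0]
    · simp [hζ1]
    · simp only [Fin.reduceFinMk, Pi.smul_apply, smul_eq_mul]
      linear_combination -ε * hx2' + x 2 * hε

theorem contDiff_phi_complexCoords : ContDiff ℝ ∞ fun v => phi (complexCoords v) := by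
  have h : ∀ i : Fin 3, ContDiff ℝ ∞ fun v : Fin 3 → ℝ => (v i : ℂ) := fun i =>
    Complex.ofRealCLM.contDiff.comp (contDiff_apply ℝ ℝ i)
  refine contDiff_pi.2 fun i => ?_
  fin_cases i
  · exact ((h 0).add ((h 1).mul contDiff_const)).pow 2
  · exact ((h 0).add ((h 1).mul contDiff_const)).mul (h 2)

theorem contDiffAt_homMap {v : Fin 3 → ℝ} (hv : v ≠ 0) : ContDiffAt ℝ ∞ homMap v := by
  have h : ContDiffAt ℝ ∞ (fun v : Fin 3 → ℝ => v 0 ^ 2 + v 1 ^ 2 + v 2 ^ 2) v := by fun_prop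
  exact (h.inv (sum_sq_ne_zero hv)).smul contDiff_phi_complexCoords.contDiffAt

theorem chartAt_eq (q : RealProjectivePlane) : ∃ i, chartAt (Fin 2 → ℝ) q = affineChart i :=
  ⟨_, rfl⟩

theorem psi_comp_affineChart_symm (i : Fin 3) : psi ∘ (affineChart i).symm =
    homMap ∘ fun y : Fin 2 → ℝ => (i.insertNth (1 : ℝ) y : Fin 3 → ℝ) := rfl

theorem contMDiff_psi : ContMDiff 𝓘(ℝ, Fin 2 → ℝ) 𝓘(ℝ, Fin 2 → ℂ) ∞ psi := by
  refine contMDiff_of_contDiffOn_comp_chartAt_symm fun q => ContDiff.contDiffOn ?_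
  obtain ⟨i, hi⟩ := chartAt_eq q
  rw [hi, psi_comp_affineChart_symm, contDiff_iff_contDiffAt]
  exact fun y => (contDiffAt_homMap (insertNth_one_ne_zero i y)).comp y
    (contDiff_pi.2 (contDiff_insertNth i)).contDiffAt

/-- The derivative of `psi` is the derivative of `homMap` at a representative `v` with `v i = 1`,
restricted to the vectors whose `i`-th coordinate is `0`. -/
theorem exists_mfderiv_psi_eq (q : RealProjectivePlane) : ∃ (i : Fin 3) (v : Fin 3 → ℝ), v i = 1 ∧
    ∀ k : Fin 2 → ℝ, mfderiv 𝓘(ℝ, Fin 2 → ℝ) 𝓘(ℝ, Fin 2 → ℂ) psi q k =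
      fderiv ℝ homMap v (insertZero i k) := by
  obtain ⟨i, hi⟩ := chartAt_eq q
  refine ⟨i, i.insertNth (1 : ℝ) (chartAt (Fin 2 → ℝ) q q), by simp, fun k => ?_⟩
  rw [mfderiv_eq_fderiv_comp_chartAt_symm (contMDiff_psi.mdifferentiableAt (by simp)), hi,
    psi_comp_affineChart_symm]
  have h := (((contDiffAt_homMap (insertNth_one_ne_zero i (affineChart i q))).differentiableAt
    (by simp)).hasFDerivAt).comp _ (hasFDerivAt_insertNth_one i (affineChart i q))
  rw [h.fderiv]
  rfl

/-- The derivative of the identity `|v|² homMap v = phi (v₁ + i v₂, v₃)` in the direction `h`. It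
determines the derivative of `homMap` without a quotient formula. -/
theorem fderiv_homMap_relation {v : Fin 3 → ℝ} (hv : v ≠ 0) (h : Fin 3 → ℝ) :
    ((v 0 ^ 2 + v 1 ^ 2 + v 2 ^ 2 : ℝ) : ℂ) * fderiv ℝ homMap v h 0 +
        ((2 * (v 0 * h 0 + v 1 * h 1 + v 2 * h 2) : ℝ) : ℂ) * homMap v 0 =
      2 * (complexCoords v 0 * complexCoords h 0) ∧
    ((v 0 ^ 2 + v 1 ^ 2 + v 2 ^ 2 : ℝ) : ℂ) * fderiv ℝ homMap v h 1 +
        ((2 * (v 0 * h 0 + v 1 * h 1 + v 2 * h 2) : ℝ) : ℂ) * homMap v 1 =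
      complexCoords h 0 * complexCoords v 1 + complexCoords v 0 * complexCoords h 1 := by
  have hline : HasDerivAt (fun t : ℝ => v + t • h) h 0 := by
    simpa using ((hasDerivAt_id (0 : ℝ)).smul_const h).const_add v
  have hR : HasDerivAt (fun t : ℝ => homMap (v + t • h)) (fderiv ℝ homMap v h) 0 :=
    HasFDerivAt.comp_hasDerivAt_of_eq (x := 0) (l := homMap) (l' := fderiv ℝ homMap v)
      ((contDiffAt_homMap hv).differentiableAt (by simp)).hasFDerivAt hline (by simp)
  have hRi := hasDerivAt_pi.1 hR
  have hx := hasDerivAt_pi.1 hline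
  have hN : HasDerivAt (fun t : ℝ => (((v + t • h) 0 ^ 2 + (v + t • h) 1 ^ 2 +
      (v + t • h) 2 ^ 2 : ℝ) : ℂ)) ((2 * (v 0 * h 0 + v 1 * h 1 + v 2 * h 2) : ℝ) : ℂ) 0 := by
    refine HasDerivAt.ofReal_comp ?_
    refine ((((hx 0).pow 2).add ((hx 1).pow 2)).add ((hx 2).pow 2)).congr_deriv ?_
    simp; ring
  have hζ : HasDerivAt (fun t : ℝ => complexCoords (v + t • h) 0) (complexCoords h 0) 0 :=
    (hx 0).ofReal_comp.add ((hx 1).ofReal_comp.mul_const Complex.I)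
  have hX : HasDerivAt (fun t : ℝ => complexCoords (v + t • h) 1) (complexCoords h 1) 0 :=
    (hx 2).ofReal_comp
  have hne : ∀ᶠ t : ℝ in nhds 0, v + t • h ≠ 0 :=
    hline.continuousAt.eventually_ne (by simpa using hv)
  constructor
  · have e1 := hN.mul (hRi 0)
    have e2 := (hζ.mul hζ).congr_of_eventuallyEq (hne.mono fun t ht =>
      (sum_sq_mul_homMap ht 0).trans (by simp [phi, sq]))
    have := e1.unique e2
    simp only [zero_smul, add_zero] at this
    rw [add_comm, this]; ring
  · have e1 := hN.mul (hRi 1)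
    have e2 := (hζ.mul hX).congr_of_eventuallyEq (hne.mono fun t ht =>
      (sum_sq_mul_homMap ht 1).trans (by simp [phi]))
    have := e1.unique e2
    simp only [zero_smul, add_zero] at this
    rw [add_comm, this]

/-! ### Injectivity of the derivative -/

theorem coords_of_complexCoords_zero_eq_zero {v : Fin 3 → ℝ} (hv : v ≠ 0)
    (h : complexCoords v 0 = 0) : v 0 = 0 ∧ v 1 = 0 ∧ v 2 ≠ 0 := by
  obtain ⟨h0, h1⟩ := eq_zero_of_add_mul_I_eq_zero h
  refine ⟨h0, h1, fun h2 => hv (funext fun i => ?_)⟩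
  fin_cases i <;> assumption

/-- The kernel of the derivative of `homMap` at `v` is the line of `v`. With `ζ = v₁ + i v₂`, the
equation for `ζ²` determines the direction of the first two coordinates of `h` if `ζ ≠ 0`, and then
the one for `ζ v₃` the third; if `ζ = 0` the latter shows that `h` is a multiple of `(0, 0, 1)`. -/
theorem exists_eq_smul_of_fderiv_homMap_eq_zero {v h : Fin 3 → ℝ} (hv : v ≠ 0)
    (h0 : fderiv ℝ homMap v h = 0) : ∃ c : ℝ, h = c • v := by
  obtain ⟨e0, e1⟩ := fderiv_homMap_relation hv h
  have s0 := sum_sq_mul_homMap hv 0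
  have s1 := sum_sq_mul_homMap hv 1
  simp only [phi, Matrix.cons_val_zero, Matrix.cons_val_one] at s0 s1
  simp only [h0, Pi.zero_apply, mul_zero, zero_add] at e0 e1
  have hN := sum_sq_ne_zero hv
  set N := v 0 ^ 2 + v 1 ^ 2 + v 2 ^ 2
  set m := v 0 * h 0 + v 1 * h 1 + v 2 * h 2
  have hNC : (N : ℂ) ≠ 0 := by exact_mod_cast hN
  by_cases hζ : complexCoords v 0 = 0
  · obtain ⟨a0, a1, a2⟩ := coords_of_complexCoords_zero_eq_zero hv hζ
    have hη : complexCoords h 0 = 0 := by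
      rw [hζ, zero_mul] at s1 e1
      rw [(mul_eq_zero.1 s1).resolve_left hNC, mul_zero, add_zero] at e1
      refine (mul_eq_zero.1 e1.symm).resolve_right ?_
      simpa [complexCoords] using a2
    obtain ⟨b0, b1⟩ := eq_zero_of_add_mul_I_eq_zero hη
    refine ⟨h 2 / v 2, funext fun i => ?_⟩
    fin_cases i
    · simp [a0, b0]
    · simp [a1, b1]
    · simp [a2]
  · have f0 : (m : ℂ) * complexCoords v 0 = N * complexCoords h 0 := by
      refine mul_left_cancel₀ hζ ?_
      push_cast at e0
      linear_combination (N : ℂ) / 2 * e0 - (m : ℂ) * s0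
    have f1 : (m : ℂ) * complexCoords v 1 = N * complexCoords h 1 := by
      refine mul_left_cancel₀ hζ ?_
      push_cast at e1
      linear_combination (N : ℂ) * e1 - 2 * (m : ℂ) * s1 - complexCoords v 1 * f0
    have g0 := congrArg Complex.re f0
    have g1 := congrArg Complex.im f0
    have g2 := congrArg Complex.re f1
    simp [complexCoords] at g0 g1 g2
    refine ⟨m / N, funext fun i => ?_⟩
    rw [Pi.smul_apply, smul_eq_mul, div_mul_eq_mul_div, eq_div_iff hN, mul_comm]
    fin_cases i
    · exact g0.symm
    · exact g1.symm
    · exact g2.symm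

theorem mfderiv_psi_injective (q : RealProjectivePlane) :
    Function.Injective (mfderiv 𝓘(ℝ, Fin 2 → ℝ) 𝓘(ℝ, Fin 2 → ℂ) psi q) := by
  obtain ⟨i, v, hv, hd⟩ := exists_mfderiv_psi_eq q
  refine (injective_iff_map_eq_zero _).2 fun k hk => ?_
  have hv0 : v ≠ 0 := by rintro rfl; simp at hv
  obtain ⟨c, hc⟩ := exists_eq_smul_of_fderiv_homMap_eq_zero hv0 ((hd k).symm.trans hk)
  have hc0 : c = 0 := by
    have h0 : insertZero i k i = 0 := Fin.insertNth_apply_same (α := fun _ => ℝ) i 0 k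
    simpa [h0, hv] using (congrFun hc i).symm
  rw [hc0, zero_smul] at hc
  exact insertZero_injective i (hc.trans (map_zero _).symm)

/-! ### Total reality of the graph -/

/-- The complex linear form `z₁ + √3 z₂`, with real part `g`. -/
noncomputable def weightedSum : (Fin 2 → ℂ) →ₗ[ℂ] ℂ :=
  LinearMap.proj 0 + ((√3 : ℝ) : ℂ) • LinearMap.proj 1

theorem weightedSum_apply (z : Fin 2 → ℂ) : weightedSum z = z 0 + √3 * z 1 := rfl

theorem g_eq_re_weightedSum (z : Fin 2 → ℂ) : g z = (weightedSum z).re := by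
  simp [g, weightedSum_apply]

/-- With `ζ = v₁ + i v₂`, the form `z₁ + √3 z₂` pulls back to the restriction to the unit sphere of
the complex quadratic form `ζ² + √3 ζ v₃`, which has no critical point there: its real and imaginary
parts have no common eigenvector. -/
theorem exists_weightedSum_fderiv_homMap_ne_zero {v : Fin 3 → ℝ} (hv : v ≠ 0) :
    ∃ h, weightedSum (fderiv ℝ homMap v h) ≠ 0 := by
  by_contra! H
  have key : ∀ h : Fin 3 → ℝ, ((2 * (v 0 * h 0 + v 1 * h 1 + v 2 * h 2) : ℝ) : ℂ) *
      weightedSum (homMap v) = 2 * (complexCoords v 0 * complexCoords h 0) + √3 *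
        (complexCoords h 0 * complexCoords v 1 + complexCoords v 0 * complexCoords h 1) := by
    intro h
    obtain ⟨e0, e1⟩ := fderiv_homMap_relation hv h
    have hH := H h
    rw [weightedSum_apply] at hH ⊢
    linear_combination e0 + √3 * e1 - ((v 0 ^ 2 + v 1 ^ 2 + v 2 ^ 2 : ℝ) : ℂ) * hH
  have k0 := key (Pi.single 0 1)
  have k1 := key (Pi.single 1 1)
  have k2 := key (Pi.single 2 1)
  have h3 : ((√3 : ℝ) : ℂ) ≠ 0 := by norm_num
  set W := weightedSum (homMap v)
  simp [complexCoords] at k0 k1 k2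
  have hW : W * (v 1 - v 0 * Complex.I) = 0 := by
    linear_combination k1 / 2 - Complex.I / 2 * k0
  rcases mul_eq_zero.1 hW with hW | hW
  · rw [hW, mul_zero] at k0 k2
    have hζ : complexCoords v 0 = 0 := (mul_eq_zero.1 k2.symm).resolve_left h3
    have h2 := (coords_of_complexCoords_zero_eq_zero hv hζ).2.2
    have hζ' : (v 0 : ℂ) + v 1 * Complex.I = 0 := hζ
    rw [hζ', mul_zero, zero_add] at k0
    exact h2 (by exact_mod_cast (mul_eq_zero.1 k0.symm).resolve_left h3)
  · have hW' : (v 1 : ℂ) + (-v 0 : ℝ) * Complex.I = 0 := by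
      push_cast; linear_combination hW
    obtain ⟨a1, a0⟩ := eq_zero_of_add_mul_I_eq_zero hW'
    have a0 : v 0 = 0 := by linarith
    have a2 : v 2 ≠ 0 :=
      (coords_of_complexCoords_zero_eq_zero hv (by simp [complexCoords, a0, a1])).2.2
    simp [a0, a1] at k0
    exact a2 k0

theorem exists_weightedSum_mfderiv_psi_ne_zero (q : RealProjectivePlane) : ∃ k : Fin 2 → ℝ,
    weightedSum (mfderiv 𝓘(ℝ, Fin 2 → ℝ) 𝓘(ℝ, Fin 2 → ℂ) psi q k) ≠ 0 := by
  obtain ⟨i, v, hv, hd⟩ := exists_mfderiv_psi_eq q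
  have hv0 : v ≠ 0 := by rintro rfl; simp at hv
  obtain ⟨h, hh⟩ := exists_weightedSum_fderiv_homMap_ne_zero hv0
  -- Euler's identity for a function homogeneous of degree `0`.
  have hvv : fderiv ℝ homMap v v = 0 := by
    have hline : HasDerivAt (fun t : ℝ => t • v) v 1 := by
      simpa using (hasDerivAt_id (1 : ℝ)).smul_const v
    have hR : HasDerivAt (fun t : ℝ => homMap (t • v)) (fderiv ℝ homMap v v) 1 :=
      HasFDerivAt.comp_hasDerivAt_of_eq (x := 1) (l := homMap) (l' := fderiv ℝ homMap v)
        ((contDiffAt_homMap hv0).differentiableAt (by simp)).hasFDerivAt hline (by simp)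
    refine hR.unique ((hasDerivAt_const (1 : ℝ) (homMap v)).congr_of_eventuallyEq ?_)
    filter_upwards [eventually_ne_nhds one_ne_zero] with t ht using homMap_smul v ht
  refine ⟨fun j => (h - h i • v) (i.succAbove j), ?_⟩
  have hins : insertZero i (fun j => (h - h i • v) (i.succAbove j)) = h - h i • v := by
    rw [insertZero_apply]
    funext m
    induction m using i.succAboveCases <;> simp [hv]
  rw [hd, hins, map_sub, map_smul, hvv, smul_zero, sub_zero]
  exact hh

/-- `graphMap` as a real-linear map. -/
noncomputable def graphMapCLM : (Fin 2 → ℂ) →L[ℝ] (Fin 3 → ℂ) :=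
  LinearMap.toContinuousLinearMap
    { toFun := graphMap
      map_add' := fun z w => by
        funext i
        fin_cases i <;> simp [graphMap, g]; ring
      map_smul' := fun c z => by
        funext i
        fin_cases i <;> simp [graphMap, g]; ring }

theorem graphMap_injective : Function.Injective graphMap := fun z w h => by
  funext i
  fin_cases i
  · exact congrFun h 0
  · exact congrFun h 1

theorem mfderiv_graphMap_comp_psi (q : RealProjectivePlane) :
    mfderiv 𝓘(ℝ, Fin 2 → ℝ) 𝓘(ℝ, Fin 3 → ℂ) (graphMap ∘ psi) q =
      graphMapCLM.comp (mfderiv 𝓘(ℝ, Fin 2 → ℝ) 𝓘(ℝ, Fin 2 → ℂ) psi q) :=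
  (graphMapCLM.hasMFDerivAt.comp q
    (contMDiff_psi.mdifferentiableAt (by simp)).hasMFDerivAt).mfderiv

theorem contMDiff_graphMap_comp_psi :
    ContMDiff 𝓘(ℝ, Fin 2 → ℝ) 𝓘(ℝ, Fin 3 → ℂ) ∞ (graphMap ∘ psi) :=
  graphMapCLM.contMDiff.comp contMDiff_psi

theorem isSmoothEmbedding_psi :
    Manifold.IsSmoothEmbedding 𝓘(ℝ, Fin 2 → ℝ) 𝓘(ℝ, Fin 2 → ℂ) ∞ psi :=
  isSmoothEmbedding_of_injective_mfderiv contMDiff_psi psi_injective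
    mfderiv_psi_injective

/-- If `w` and `i w` are tangent to the graph of `g`, then `z₁ + √3 z₂` vanishes on both of them,
since the last coordinate is real on tangent vectors and `g` is the real part of `z₁ + √3 z₂`. If
`w ≠ 0`, they span the tangent plane, and `z₁ + √3 z₂` vanishes on all of it. -/
theorem isTotallyRealSubspace_range_graphMapCLM_comp {T : (Fin 2 → ℝ) →L[ℝ] (Fin 2 → ℂ)}
    (hT : ∃ k, weightedSum (T k) ≠ 0) :
    IsTotallyRealSubspace (LinearMap.range (graphMapCLM.comp T).toLinearMap) := by
  rintro _ ⟨k, rfl⟩ ⟨k', hk'⟩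
  have e : graphMap (T k') = Complex.I • graphMap (T k) := hk'
  have e0 : T k' 0 = Complex.I * T k 0 := congrFun e 0
  have e1 : T k' 1 = Complex.I * T k 1 := congrFun e 1
  have e2 : (g (T k') : ℂ) = Complex.I * (g (T k) : ℂ) := congrFun e 2
  have hT' : T k' = Complex.I • T k := by
    funext j
    fin_cases j
    · exact e0
    · exact e1
  have hw' : weightedSum (T k') = Complex.I * weightedSum (T k) := by rw [hT', map_smul]; rfl
  have hg : g (T k) = 0 := by simpa using (congrArg Complex.im e2).symm
  have hg' : g (T k') = 0 := by simpa using congrArg Complex.re e2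
  have hw : weightedSum (T k) = 0 := by
    apply Complex.ext
    · simpa [g_eq_re_weightedSum] using hg
    · rw [g_eq_re_weightedSum, hw'] at hg'
      simpa using hg'
  rw [hw, mul_zero] at hw'
  suffices hTk : T k = 0 by
    change graphMapCLM (T k) = 0
    rw [hTk, map_zero]
  by_contra hne
  -- `T` maps a real combination `s k + t k'` to `(s + i t) T k`.
  have hli : LinearIndependent ℝ ![k, k'] := by
    rw [LinearIndependent.pair_iff]
    intro s t hst
    have h1 : ((s : ℂ) + t * Complex.I) • T k = 0 := by
      have := congrArg T hst
      rw [map_add, map_smul, map_smul, map_zero, hT'] at this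
      rw [add_smul, mul_smul]
      exact this
    exact eq_zero_of_add_mul_I_eq_zero ((smul_eq_zero.1 h1).resolve_right hne)
  have hspan := hli.span_eq_top_of_card_eq_finrank (by simp)
  obtain ⟨l, hl⟩ := hT
  have hlm : l ∈ Submodule.span ℝ (Set.range ![k, k']) := hspan ▸ Submodule.mem_top
  rw [Matrix.range_cons, Matrix.range_cons, Matrix.range_empty, Set.union_empty,
    Set.singleton_union, Submodule.mem_span_pair] at hlm
  obtain ⟨s, t, rfl⟩ := hlm
  refine hl ?_
  have : T (s • k + t • k') = (s : ℂ) • T k + (t : ℂ) • T k' := by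
    rw [map_add, map_smul, map_smul]; rfl
  rw [this, map_add, map_smul, map_smul, hw, hw', smul_zero, smul_zero, add_zero]

theorem isTotallyRealEmbedding_graphMap_comp_psi :
    IsTotallyRealEmbedding (E := Fin 2 → ℝ) (graphMap ∘ psi) where
  isSmoothEmbedding := isSmoothEmbedding_of_injective_mfderiv
    contMDiff_graphMap_comp_psi (graphMap_injective.comp psi_injective) fun q => by
      rw [mfderiv_graphMap_comp_psi]
      exact graphMap_injective.comp (mfderiv_psi_injective q)
  isTotallyRealSubspace_tangent q := by
    rw [mfderiv_graphMap_comp_psi]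
    exact isTotallyRealSubspace_range_graphMapCLM_comp (exists_weightedSum_mfderiv_psi_ne_zero q)

theorem contMDiff_g_comp_psi : ContMDiff 𝓘(ℝ, Fin 2 → ℝ) 𝓘(ℝ, ℝ) ∞ (g ∘ psi) := by
  have hg : ContDiff ℝ ∞ g :=
    ((Complex.reCLM.contDiff.comp (contDiff_apply ℝ ℂ 0)).add
      (contDiff_const.mul (Complex.reCLM.contDiff.comp (contDiff_apply ℝ ℂ 1))))
  exact hg.contMDiff.comp contMDiff_psi

end ProjectivePlaneFunction

open ProjectivePlaneFunction in
theorem mainTheorem4 :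
    (∃ ψ : RealProjectivePlane → Fin 2 → ℂ,
      (∀ (x : Fin 3 → ℝ) (hx : x ≠ 0), x 0 ^ 2 + x 1 ^ 2 + x 2 ^ 2 = 1 →
        ψ (Projectivization.mk ℝ x hx) = phi ![(x 0 : ℂ) + (x 1 : ℂ) * Complex.I, (x 2 : ℂ)]) ∧
      Manifold.IsSmoothEmbedding 𝓘(ℝ, Fin 2 → ℝ) 𝓘(ℝ, Fin 2 → ℂ) ∞ ψ ∧
      Set.range ψ = surface ∧
      ContMDiff 𝓘(ℝ, Fin 2 → ℝ) 𝓘(ℝ, ℝ) ∞ (g ∘ ψ) ∧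
      IsTotallyRealEmbedding (E := Fin 2 → ℝ) (graphMap ∘ ψ)) ∧
    (∀ t : ℝ, IsPolynomiallyConvex (fibre t) ∧ polynomialAlgebra (fibre t) = ⊤) ∧
    IsGreatest (g '' surface) (3 / 2) ∧
    fibre (3 / 2) = {![3 / 4, ((√3 : ℝ) : ℂ) / 4]} ∧
    IsLeast (g '' surface) (-1) ∧
    fibre (-1) = {![-1, 0]} :=
  ⟨⟨psi, fun _ hx h => psi_mk_of_sum_sq_eq_one hx h, isSmoothEmbedding_psi, range_psi,
      contMDiff_g_comp_psi, isTotallyRealEmbedding_graphMap_comp_psi⟩,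
    fun t => ⟨isPolynomiallyConvex_of_polynomialAlgebra_eq_top (polynomialAlgebra_fibre_eq_top t),
      polynomialAlgebra_fibre_eq_top t⟩,
    isGreatest_g, fibre_three_halves, isLeast_g, fibre_neg_one⟩
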